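/- Let $(G,c)$ be a resistance network with vertex set $V$: the conductances $c_{xy}=c_{yx}\in[0,\infty)$ satisfy $c_{xx}=0$ and $\sum_y c_{xy}<\infty$ for every $x\in V$ (infinitely many neighbours are allowed), and the graph on $V\neq\emptyset$ in which $x\sim y$ iff $c_{xy}>0$ is connected. Fix $o\in V$. All functions and Hilbert spaces are real. For $u,v:V\to\mathbb R$ put $\mathcal E(u,v)=\frac12\sum_{x,y\in V}c_{xy}(u(x)-u(y))(v(x)-v(y))$, let $\operatorname{dom}\mathcal E=\{u:\mathcal E(u,u)<\infty\}$, and let $\mathcal H_{\mathcal E}$ be the Hilbert space $\operatorname{dom}\mathcal E/\{\text{constants}\}$ with inner product $\mathcal E$. Let $v_x\in\mathcal H_{\mathcal E}$ be the unique element with $\langle v_x,u\rangle_{\mathcal E}=u(x)-u(o)$ for all $u\in\mathcal H_{\mathcal E}$. Let $\mathrm{Fin}$ be the closure in $\mathcal H_{\mathcal E}$ of the span of the Dirac masses $\delta_x$, $x\in V$, and let $f_x$ be the orthogonal projection of $v_x$ to $\mathrm{Fin}$. On a finite network, the effective resistance between $x$ and $y$ is $v(x)-v(y)$, where $v$ solves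 $\Delta v=\delta_x-\delta_y$, with $\Delta v(z)=\sum_{w}c_{zw}(v(z)-v(w))$. An exhaustion is an increasing sequence of finite vertex sets $G_k$ with union $V$, each spanning a connected full subnetwork $G_k^F$; $G_k^W$ is obtained from $G_k^F$ by adding one vertex $\infty$, joined to each $x\in G_k$ with conductance $\sum_{y\notin G_k}c_{xy}$. The free and wired resistances are $R^F(x,y)=\lim_k R_{G_k^F}(x,y)$ and $R^W(x,y)=\lim_k R_{G_k^W}(x,y)$. For $R:V\times V\to\mathbb R$, a von Neumann embedding of $(V,R)$ into a Hilbert space $K$ is a map $k:V\to K$ with $\|k_x-k_y\|^2=R(x,y)$ for all $x,y$ such that the span of all differences $k_x-k_y$ is dense in $K$. If $R$ is symmetric and negative semidefinite (that is, $\sum_{x,y\in F}f(x)R(x,y)f(y)\le 0$ whenever $F\subseteq V$ is finite and $\sum_{x\in F}f(x)=0$), von Neumann's construction is the completion $\mathcal H_{vN}(R)$ of the space of finitely supported functions $f:V\to\mathbb R$ with sum $0$, modulo the kernel of the form $Q(f,g)=-\sum_{x,y}f(x)R(x,y)g(y)$, with inner product $Q$ and with the map $x\mapsto w_x=\frac1{\sqrt2}(\delta_x-\delta_o)$.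 Then exhaustions exist, and for all $x,y\in V$ both limits $R^F(x,y)$ and $R^W(x,y)$ exist along every exhaustion and do not depend on it. Moreover: 1. The map $x\mapsto v_x$ is injective and is a von Neumann embedding of $(V,R^F)$ into $\mathcal H_{\mathcal E}$. The function $R^F$ is symmetric and negative semidefinite, and there is a unique unitary isomorphism $U:\mathcal H_{vN}(R^F)\to\mathcal H_{\mathcal E}$ with $Uw_x=v_x$ for all $x\in V$. For every von Neumann embedding $k$ of $(V,R^F)$ into a Hilbert space $K$ there is a unique unitary isomorphism $U:\mathcal H_{\mathcal E}\to K$ with $U(v_x-v_y)=k_x-k_y$ for all $x,y\in V$. 2. The map $x\mapsto f_x$ is injective and is a von Neumann embedding of $(V,R^W)$ into $\mathrm{Fin}$. The function $R^W$ is symmetric and negative semidefinite, and there is a unique unitary isomorphism $U:\mathcal H_{vN}(R^W)\to\mathrm{Fin}$ with $Uw_x=f_x$ for all $x\in V$. For every von Neumann embedding $k$ of $(V,R^W)$ into a Hilbert space $K$ there is a unique unitary isomorphism $U:\mathrm{Fin}\to K$ with $U(f_x-f_y)=k_x-k_y$ for all $x,y\in V$. -/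

import Mathlib

open Filter Topology

/-! ### Resistance networks -/

/-- A resistance network: a (nonempty) connected weighted graph with vertex set `V`, whose
conductances `c x y` are symmetric, nonnegative, vanish on the diagonal, and have finite sum at
every vertex (infinitely many neighbours are allowed). Vertices are adjacent iff `0 < c x y`. -/
structure ResistanceNetwork (V : Type*) where
  c : V → V → ℝ
  c_nonneg : ∀ x y, 0 ≤ c x y
  c_symm : ∀ x y, c x y = c y x
  c_self : ∀ x, c x x = 0
  summable_c : ∀ x, Summable (c x)
  nonempty : Nonempty V
  connected : ∀ x y, Relation.ReflTransGen (fun a b => 0 < c a b) x y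

/-! ### Effective resistance on finite networks, free and wired resistance -/

noncomputable section

/-- The Laplacian `(Δ v)(x) = ∑_y c x y (v x - v y)` of a finite network. -/
def finiteLaplacian {W : Type*} [Fintype W] (c : W → W → ℝ) (v : W → ℝ) (x : W) : ℝ :=
  ∑ y, c x y * (v x - v y)

open Classical in
/-- `v` is a voltage function for the unit current which enters the finite network at `x` and
leaves it at `y`: `Δ v = δ_x - δ_y`. -/
def IsUnitVoltage {W : Type*} [Fintype W] (c : W → W → ℝ) (x y : W) (v : W → ℝ) : Prop :=
  ∀ z, finiteLaplacian c v z = (if z = x then 1 else 0) - (if z = y then 1 else 0)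

/-- The effective resistance between `x` and `y` in a finite network: the voltage drop
`v x - v y`, where `v` is any solution of `Δ v = δ_x - δ_y`. -/
def effectiveResistance {W : Type*} [Fintype W] (c : W → W → ℝ) (x y : W) : ℝ :=
  Classical.epsilon (IsUnitVoltage c x y) x - Classical.epsilon (IsUnitVoltage c x y) y

namespace ResistanceNetwork

variable {V : Type*} (N : ResistanceNetwork V)

/-- An exhaustion of the network: an increasing sequence of finite vertex sets, each of which
spans a connected full subnetwork, with union the whole vertex set. -/
structure IsExhaustion (G : ℕ → Finset V) : Prop where
  mono : Monotone G
  exhausts : ∀ x, ∃ k, x ∈ G k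
  connected : ∀ k, ∀ x ∈ G k, ∀ y ∈ G k,
    Relation.ReflTransGen (fun a b => a ∈ G k ∧ b ∈ G k ∧ 0 < N.c a b) x y

/-- The conductances of the free (that is, full) subnetwork on the finite vertex set `H`. -/
def freeConductance (H : Finset V) : H → H → ℝ := fun a b => N.c a b

open Classical in
/-- The conductances of the wired subnetwork on the finite vertex set `H`: all vertices outside
`H` are identified to one new vertex `∞`, which is `none : Option H`. -/
def wiredConductance (H : Finset V) : Option H → Option H → ℝ
  | some a, some b => N.c a b
  | some a, none => ∑' y, if y ∈ H then 0 else N.c a y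
  | none, some b => ∑' y, if y ∈ H then 0 else N.c b y
  | none, none => 0

open Classical in
/-- The effective resistance between `x` and `y` computed in the free subnetwork on `H`
(the value `0` for `x` or `y` outside `H` is immaterial). -/
def freeResistanceOn (H : Finset V) (x y : V) : ℝ :=
  if h : x ∈ H ∧ y ∈ H then
    effectiveResistance (N.freeConductance H) ⟨x, h.1⟩ ⟨y, h.2⟩
  else 0

open Classical in
/-- The effective resistance between `x` and `y` computed in the wired subnetwork on `H`
(the value `0` for `x` or `y` outside `H` is immaterial). -/
def wiredResistanceOn (H : Finset V) (x y : V) : ℝ :=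
  if h : x ∈ H ∧ y ∈ H then
    effectiveResistance (N.wiredConductance H) (some ⟨x, h.1⟩) (some ⟨y, h.2⟩)
  else 0

/-- `r` is the limit of the resistances between `x` and `y` in the free subnetworks, along
every exhaustion. -/
def IsFreeLimit (x y : V) (r : ℝ) : Prop :=
  ∀ G : ℕ → Finset V, N.IsExhaustion G →
    Tendsto (fun k => N.freeResistanceOn (G k) x y) atTop (𝓝 r)

/-- `r` is the limit of the resistances between `x` and `y` in the wired subnetworks, along
every exhaustion. -/
def IsWiredLimit (x y : V) (r : ℝ) : Prop :=
  ∀ G : ℕ → Finset V, N.IsExhaustion G →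
    Tendsto (fun k => N.wiredResistanceOn (G k) x y) atTop (𝓝 r)

/-- The free resistance `R^F`. -/
def freeResistance (x y : V) : ℝ := Classical.epsilon (N.IsFreeLimit x y)

/-- The wired resistance `R^W`. -/
def wiredResistance (x y : V) : ℝ := Classical.epsilon (N.IsWiredLimit x y)

/-! ### The energy space -/

/-- The functions `u : V → ℝ` of finite energy. -/
def dom : Submodule ℝ (V → ℝ) where
  carrier := {u | Summable fun p : V × V => N.c p.1 p.2 * (u p.1 - u p.2) ^ 2}
  zero_mem' := by simp [summable_zero]
  add_mem' := by
    intro u v hu hv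
    refine Summable.of_nonneg_of_le
      (fun p => mul_nonneg (N.c_nonneg _ _) (sq_nonneg _)) (fun p => ?_)
      ((hu.mul_left 2).add (hv.mul_left 2))
    have := mul_nonneg (N.c_nonneg p.1 p.2) (sq_nonneg ((u p.1 - u p.2) - (v p.1 - v p.2)))
    simp only [Pi.add_apply]
    nlinarith
  smul_mem' := by
    intro a u hu
    refine (hu.mul_left (a ^ 2)).congr (fun p => ?_)
    simp only [Pi.smul_apply, smul_eq_mul]
    ring

lemma summable_energy (u v : N.dom) : Summable fun p : V × V =>
    N.c p.1 p.2 * (u.1 p.1 - u.1 p.2) * (v.1 p.1 - v.1 p.2) := by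
  refine Summable.of_norm_bounded (u.2.add v.2) (fun p => ?_)
  have h0 := N.c_nonneg p.1 p.2
  have h1 := mul_nonneg h0 (sq_nonneg ((u.1 p.1 - u.1 p.2) - (v.1 p.1 - v.1 p.2)))
  have h2 := mul_nonneg h0 (sq_nonneg ((u.1 p.1 - u.1 p.2) + (v.1 p.1 - v.1 p.2)))
  have h3 := mul_nonneg h0 (sq_nonneg (u.1 p.1 - u.1 p.2))
  have h4 := mul_nonneg h0 (sq_nonneg (v.1 p.1 - v.1 p.2))
  rw [Real.norm_eq_abs, abs_le]
  constructor <;> nlinarith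

/-- The energy form `E(u,v) = 1/2 ∑_{x,y} c x y (u x - u y) (v x - v y)` on functions of finite
energy. -/
def energy (u v : N.dom) : ℝ :=
  1 / 2 * ∑' p : V × V, N.c p.1 p.2 * (u.1 p.1 - u.1 p.2) * (v.1 p.1 - v.1 p.2)

lemma energy_comm (u v : N.dom) : N.energy u v = N.energy v u := by
  unfold energy
  congr 1
  exact tsum_congr fun p => by ring

lemma energy_add_left (u v w : N.dom) : N.energy (u + v) w = N.energy u w + N.energy v w := by
  unfold energy
  rw [← mul_add, ← (N.summable_energy u w).tsum_add (N.summable_energy v w)]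
  congr 1
  exact tsum_congr fun p => by simp only [Submodule.coe_add, Pi.add_apply]; ring

lemma energy_smul_left (a : ℝ) (u w : N.dom) : N.energy (a • u) w = a * N.energy u w := by
  unfold energy
  rw [mul_left_comm, ← tsum_mul_left (a := a)]
  refine congrArg (fun t => 1 / 2 * t) ?_
  exact tsum_congr fun p => by simp only [Submodule.coe_smul, Pi.smul_apply, smul_eq_mul]; ring

lemma energy_self_nonneg (u : N.dom) : 0 ≤ N.energy u u := by
  refine mul_nonneg (by norm_num) (tsum_nonneg fun p => ?_)
  rw [mul_assoc]
  exact mul_nonneg (N.c_nonneg _ _) (mul_self_nonneg _)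

/-- The constant functions, as a subspace of the functions of finite energy. -/
def constants : Submodule ℝ N.dom where
  carrier := {u | ∃ k : ℝ, ∀ x, u.1 x = k}
  zero_mem' := ⟨0, fun _ => rfl⟩
  add_mem' := by
    rintro u v ⟨k, hk⟩ ⟨l, hl⟩
    exact ⟨k + l, fun x => by simp [hk x, hl x]⟩
  smul_mem' := by
    rintro a u ⟨k, hk⟩
    exact ⟨a * k, fun x => by simp [hk x]⟩

/-- The energy space `H_E`: functions of finite energy modulo constants. -/
def EnergySpace : Type _ := N.dom ⧸ N.constants

instance : AddCommGroup N.EnergySpace := inferInstanceAs (AddCommGroup (N.dom ⧸ N.constants))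
instance : Module ℝ N.EnergySpace := inferInstanceAs (Module ℝ (N.dom ⧸ N.constants))

/-- The class modulo constants of a function of finite energy. -/
def toEnergySpace : N.dom →ₗ[ℝ] N.EnergySpace := N.constants.mkQ

lemma toEnergySpace_surjective : Function.Surjective N.toEnergySpace :=
  N.constants.mkQ_surjective

lemma toEnergySpace_eq_iff (u v : N.dom) :
    N.toEnergySpace u = N.toEnergySpace v ↔ ∃ k : ℝ, ∀ x, u.1 x - v.1 x = k :=
  Submodule.Quotient.eq N.constants

lemma energy_congr {u u' v v' : N.dom} (hu : N.toEnergySpace u = N.toEnergySpace u')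
    (hv : N.toEnergySpace v = N.toEnergySpace v') : N.energy u v = N.energy u' v' := by
  obtain ⟨k, hk⟩ := (N.toEnergySpace_eq_iff _ _).1 hu
  obtain ⟨l, hl⟩ := (N.toEnergySpace_eq_iff _ _).1 hv
  unfold energy
  congr 1
  refine tsum_congr fun p => ?_
  have e1 : u.1 p.1 - u.1 p.2 = u'.1 p.1 - u'.1 p.2 := by linarith [hk p.1, hk p.2]
  have e2 : v.1 p.1 - v.1 p.2 = v'.1 p.1 - v'.1 p.2 := by linarith [hl p.1, hl p.2]
  rw [e1, e2]

lemma sq_sub_le_energy (u : N.dom) (a b : V) :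
    N.c a b * (u.1 a - u.1 b) ^ 2 ≤ 2 * N.energy u u := by
  have h := (N.summable_energy u u).le_tsum (a, b) (fun p _ => by
    rw [mul_assoc]; exact mul_nonneg (N.c_nonneg _ _) (mul_self_nonneg _))
  unfold energy
  simp only at h
  nlinarith [h]

/-- Differences of values are controlled by the energy. -/
lemma exists_bound (x y : V) :
    ∃ C : ℝ, ∀ u : N.dom, |u.1 x - u.1 y| ≤ C * √(N.energy u u) := by
  induction N.connected x y with
  | refl => exact ⟨0, fun u => by simp⟩
  | @tail a b _ hab ih =>
    obtain ⟨C, hC⟩ := ih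
    refine ⟨C + √(2 / N.c a b), fun u => ?_⟩
    have h1 : |u.1 a - u.1 b| ≤ √(2 / N.c a b) * √(N.energy u u) := by
      rw [← Real.sqrt_mul (by positivity)]
      apply Real.abs_le_sqrt
      rw [div_mul_eq_mul_div, le_div_iff₀ hab]
      linarith [N.sq_sub_le_energy u a b]
    calc |u.1 x - u.1 b| ≤ |u.1 x - u.1 a| + |u.1 a - u.1 b| := abs_sub_le _ _ _
      _ ≤ _ := by rw [add_mul]; exact add_le_add (hC u) h1

lemma toEnergySpace_eq_zero_of_energy {u : N.dom} (hu : N.energy u u = 0) :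
    N.toEnergySpace u = 0 := by
  obtain ⟨o⟩ := N.nonempty
  rw [← map_zero N.toEnergySpace, toEnergySpace_eq_iff]
  refine ⟨u.1 o, fun x => ?_⟩
  obtain ⟨C, hC⟩ := N.exists_bound x o
  have h := hC u
  rw [hu, Real.sqrt_zero, mul_zero] at h
  have h' := abs_nonpos_iff.1 h
  simp only [Submodule.coe_zero, Pi.zero_apply]
  linarith

/-- The inner product of `H_E`: the energy form of any representatives. -/
def energyInner (a b : N.EnergySpace) : ℝ :=
  Quotient.liftOn₂' a b N.energy fun _ _ _ _ h h' =>
    N.energy_congr (Quotient.sound' h) (Quotient.sound' h')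

lemma energyInner_mk (u v : N.dom) :
    N.energyInner (N.toEnergySpace u) (N.toEnergySpace v) = N.energy u v := rfl

/-- The energy form is an inner product on `H_E`. -/
@[reducible]
def energyCore : InnerProductSpace.Core ℝ N.EnergySpace where
  inner := N.energyInner
  conj_inner_symm a b := by
    obtain ⟨u, rfl⟩ := N.toEnergySpace_surjective a
    obtain ⟨v, rfl⟩ := N.toEnergySpace_surjective b
    simp only [energyInner_mk, conj_trivial]
    exact N.energy_comm v u
  re_inner_nonneg a := by
    obtain ⟨u, rfl⟩ := N.toEnergySpace_surjective a
    exact N.energy_self_nonneg u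
  add_left a b d := by
    obtain ⟨u, rfl⟩ := N.toEnergySpace_surjective a
    obtain ⟨v, rfl⟩ := N.toEnergySpace_surjective b
    obtain ⟨w, rfl⟩ := N.toEnergySpace_surjective d
    rw [← map_add]
    exact N.energy_add_left u v w
  smul_left a b r := by
    obtain ⟨u, rfl⟩ := N.toEnergySpace_surjective a
    obtain ⟨v, rfl⟩ := N.toEnergySpace_surjective b
    rw [← map_smul]
    exact N.energy_smul_left r u v
  definite a h := by
    obtain ⟨u, rfl⟩ := N.toEnergySpace_surjective a
    exact N.toEnergySpace_eq_zero_of_energy h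

instance : NormedAddCommGroup N.EnergySpace :=
  InnerProductSpace.Core.toNormedAddCommGroup (cd := N.energyCore)

instance : InnerProductSpace ℝ N.EnergySpace := InnerProductSpace.ofCore N.energyCore.toCore

lemma inner_toEnergySpace (u v : N.dom) :
    inner ℝ (N.toEnergySpace u) (N.toEnergySpace v) = N.energy u v := rfl

lemma norm_toEnergySpace (u : N.dom) : ‖N.toEnergySpace u‖ = √(N.energy u u) := rfl

/-- The functional `u ↦ u x - u y` on `H_E`. -/
def potentialDiff (x y : V) : N.EnergySpace →L[ℝ] ℝ :=
  LinearMap.mkContinuousOfExistsBound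
    (N.constants.liftQ
      (((LinearMap.proj x : (V → ℝ) →ₗ[ℝ] ℝ) - LinearMap.proj y).comp N.dom.subtype)
      (by
        rintro u ⟨k, hk⟩
        simp [hk x, hk y]) : N.EnergySpace →ₗ[ℝ] ℝ)
    (by
      obtain ⟨C, hC⟩ := N.exists_bound x y
      refine ⟨C, fun a => ?_⟩
      obtain ⟨u, rfl⟩ := N.toEnergySpace_surjective a
      exact hC u)

lemma potentialDiff_mk (x y : V) (u : N.dom) :
    N.potentialDiff x y (N.toEnergySpace u) = u.1 x - u.1 y := rfl

lemma sum_le_energy (u : N.dom) (s : Finset (V × V)) :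
    ∑ p ∈ s, N.c p.1 p.2 * (u.1 p.1 - u.1 p.2) ^ 2 ≤ 2 * N.energy u u := by
  have h := (N.summable_energy u u).sum_le_tsum s (fun p _ => by
    rw [mul_assoc]; exact mul_nonneg (N.c_nonneg _ _) (mul_self_nonneg _))
  have h2 : 2 * N.energy u u =
      ∑' p : V × V, N.c p.1 p.2 * (u.1 p.1 - u.1 p.2) * (u.1 p.1 - u.1 p.2) := by
    unfold energy; ring
  rw [h2]
  refine le_trans (le_of_eq (Finset.sum_congr rfl fun p _ => by ring)) h

lemma energy_eq_norm_sq (u : N.dom) : N.energy u u = ‖N.toEnergySpace u‖ ^ 2 := by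
  rw [norm_toEnergySpace, Real.sq_sqrt (N.energy_self_nonneg u)]

/-- `H_E` is complete, so that it is a Hilbert space. -/
instance : CompleteSpace N.EnergySpace := by
  refine Metric.complete_of_cauchySeq_tendsto fun a ha => ?_
  obtain ⟨o⟩ := N.nonempty
  choose u hu using fun n => N.toEnergySpace_surjective (a n)
  have hlim : ∀ x, ∃ r, Tendsto (fun n => (u n).1 x - (u n).1 o) atTop (𝓝 r) := by
    intro x
    have h : CauchySeq fun n => N.potentialDiff x o (a n) :=
      ha.map (N.potentialDiff x o).uniformContinuous
    obtain ⟨r, hr⟩ := cauchySeq_tendsto_of_complete h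
    refine ⟨r, hr.congr fun n => ?_⟩
    rw [← hu n, potentialDiff_mk]
  choose g hg using hlim
  have hdiff : ∀ x y, Tendsto (fun n => (u n).1 x - (u n).1 y) atTop (𝓝 (g x - g y)) := by
    intro x y
    exact ((hg x).sub (hg y)).congr fun n => by ring
  have key : ∀ ε > 0, ∃ n₀, ∀ n ≥ n₀, ∀ s : Finset (V × V),
      ∑ p ∈ s, N.c p.1 p.2 * (((u n).1 - g) p.1 - ((u n).1 - g) p.2) ^ 2 ≤ 2 * ε ^ 2 := by
    intro ε hε
    obtain ⟨n₀, hn₀⟩ := Metric.cauchySeq_iff.1 ha ε hε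
    refine ⟨n₀, fun n hn s => ?_⟩
    have ht : Tendsto (fun m => ∑ p ∈ s, N.c p.1 p.2 *
        (((u n).1 p.1 - (u n).1 p.2) - ((u m).1 p.1 - (u m).1 p.2)) ^ 2) atTop
        (𝓝 (∑ p ∈ s, N.c p.1 p.2 *
          (((u n).1 p.1 - (u n).1 p.2) - (g p.1 - g p.2)) ^ 2)) :=
      tendsto_finsetSum s fun p _ =>
        ((tendsto_const_nhds.sub (hdiff p.1 p.2)).pow 2).const_mul _
    have hle := le_of_tendsto ht (b := 2 * ε ^ 2) (by
      filter_upwards [eventually_ge_atTop n₀] with m hm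
      have h1 := N.sum_le_energy (u n - u m) s
      have h2 : ‖N.toEnergySpace (u n - u m)‖ < ε := by
        rw [map_sub, hu, hu, ← dist_eq_norm]
        exact hn₀ n hn m hm
      rw [energy_eq_norm_sq] at h1
      have h3 := pow_le_pow_left₀ (norm_nonneg _) h2.le 2
      refine le_trans (le_of_eq (Finset.sum_congr rfl fun p _ => ?_))
        (h1.trans (mul_le_mul_of_nonneg_left h3 (by norm_num)))
      simp only [Submodule.coe_sub, Pi.sub_apply]
      ring)
    refine le_trans (le_of_eq (Finset.sum_congr rfl fun p _ => ?_)) hle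
    simp only [Pi.sub_apply]
    ring
  have hmem : ∀ ε > 0, ∃ n₀, ∀ n ≥ n₀, ∃ h : (u n).1 - g ∈ N.dom,
      ‖N.toEnergySpace ⟨(u n).1 - g, h⟩‖ ≤ ε := by
    intro ε hε
    obtain ⟨n₀, hn₀⟩ := key ε hε
    refine ⟨n₀, fun n hn => ?_⟩
    have hnn : ∀ p : V × V, 0 ≤ N.c p.1 p.2 * (((u n).1 - g) p.1 - ((u n).1 - g) p.2) ^ 2 :=
      fun p => mul_nonneg (N.c_nonneg _ _) (sq_nonneg _)
    have h : (u n).1 - g ∈ N.dom := summable_of_sum_le hnn (hn₀ n hn)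
    refine ⟨h, ?_⟩
    rw [norm_toEnergySpace]
    refine Real.sqrt_le_iff.2 ⟨hε.le, ?_⟩
    have h1 := Real.tsum_le_of_sum_le hnn (hn₀ n hn)
    have h2 : 2 * N.energy ⟨(u n).1 - g, h⟩ ⟨(u n).1 - g, h⟩ =
        ∑' p : V × V, N.c p.1 p.2 * (((u n).1 - g) p.1 - ((u n).1 - g) p.2) ^ 2 := by
      unfold energy
      rw [← mul_assoc]
      norm_num
      exact tsum_congr fun p => by ring
    linarith
  have hgdom : g ∈ N.dom := by
    obtain ⟨n₀, hn₀⟩ := hmem 1 one_pos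
    obtain ⟨h, -⟩ := hn₀ n₀ le_rfl
    have := N.dom.sub_mem (u n₀).2 h
    rwa [sub_sub_cancel] at this
  refine ⟨N.toEnergySpace ⟨g, hgdom⟩, Metric.tendsto_atTop.2 fun ε hε => ?_⟩
  obtain ⟨n₀, hn₀⟩ := hmem (ε / 2) (half_pos hε)
  refine ⟨n₀, fun n hn => ?_⟩
  obtain ⟨h, hle⟩ := hn₀ n hn
  have heq : a n - N.toEnergySpace ⟨g, hgdom⟩ = N.toEnergySpace ⟨(u n).1 - g, h⟩ := by
    rw [← hu n, ← map_sub]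
    rfl
  rw [dist_eq_norm, heq]
  linarith

/-! ### The energy kernel, the space `Fin`, and the projected kernel -/

/-- The energy kernel `v_x` with respect to the reference vertex `o`: the element of `H_E` which
represents (Riesz) the functional `u ↦ u x - u o`. -/
def energyKernel (o x : V) : N.EnergySpace :=
  (InnerProductSpace.toDual ℝ N.EnergySpace).symm (N.potentialDiff x o)

lemma inner_energyKernel (o x : V) (u : N.dom) :
    inner ℝ (N.energyKernel o x) (N.toEnergySpace u) = u.1 x - u.1 o := by
  rw [energyKernel, InnerProductSpace.toDual_symm_apply, potentialDiff_mk]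

open Classical in
/-- The Dirac function at `x` has finite energy. -/
lemma dirac_mem_dom (x : V) : (fun y => if y = x then (1 : ℝ) else 0) ∈ N.dom := by
  have h1 : Summable fun p : V × V => (if p.1 = x then N.c x p.2 else 0) := by
    have hinj : Function.Injective (fun y : V => (x, y)) := fun a b h => (Prod.mk.inj h).2
    refine (hinj.summable_iff ?_).1 ?_
    · rintro ⟨p, q⟩ hp
      refine if_neg fun h => hp ⟨q, ?_⟩
      simp only at h ⊢
      rw [h]
    · exact (N.summable_c x).congr fun y => by simp
  have h2 : Summable fun p : V × V => (if p.2 = x then N.c x p.1 else 0) :=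
    ((Equiv.prodComm V V).summable_iff.2 h1 : _)
  refine Summable.of_nonneg_of_le
    (fun p => mul_nonneg (N.c_nonneg _ _) (sq_nonneg _)) (fun p => ?_) (h1.add h2)
  have e1 : p.1 = x → N.c p.1 p.2 = N.c x p.2 := fun h => by rw [h]
  have e2 : p.2 = x → N.c p.1 p.2 = N.c x p.1 := fun h => by rw [h, N.c_symm]
  have n1 := N.c_nonneg x p.2
  have n2 := N.c_nonneg x p.1
  by_cases hp : p.1 = x <;> by_cases hq : p.2 = x
  · simp [hp, hq]; exact N.c_nonneg _ _
  · simp [hp, hq]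
  · simp [hp, hq, N.c_symm p.1 x]
  · simp [hp, hq]

open Classical in
/-- The Dirac mass `δ_x` as an element of `H_E`. -/
def dirac (x : V) : N.EnergySpace :=
  N.toEnergySpace ⟨fun y => if y = x then 1 else 0, N.dirac_mem_dom x⟩

/-- `Fin`: the closure in `H_E` of the linear span of the Dirac masses, i.e. of the functions
which are constant off a finite set. -/
def FinSpace : Submodule ℝ N.EnergySpace :=
  (Submodule.span ℝ (Set.range N.dirac)).topologicalClosure

instance : CompleteSpace N.FinSpace :=
  inferInstanceAs (CompleteSpace (Submodule.span ℝ (Set.range N.dirac)).topologicalClosure)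

/-- `f_x`: the orthogonal projection of `v_x` to `Fin`. -/
def finKernel (o x : V) : N.FinSpace :=
  N.FinSpace.orthogonalProjectionOnto (N.energyKernel o x)

end ResistanceNetwork

/-! ### Von Neumann embeddings -/

/-- `w : X → E` embeds `X`, with the squared distance function `R = d ^ 2`, isometrically in
`E`, and no proper closed subspace of `E` contains all differences `w x - w y` (that is, the
image is contained in no translate of a proper closed subspace). -/
structure IsVonNeumannEmbedding {X E : Type*} [NormedAddCommGroup E] [InnerProductSpace ℝ E]
    (R : X → X → ℝ) (w : X → E) : Prop where
  isometric : ∀ x y, ‖w x - w y‖ ^ 2 = R x y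
  dense : (Submodule.span ℝ (Set.range fun p : X × X => w p.1 - w p.2)).topologicalClosure = ⊤

/-- `R = d ^ 2` is symmetric and negative semidefinite (on families of coefficients with sum
zero). -/
structure IsNegativeSemidefinite {X : Type*} (R : X → X → ℝ) : Prop where
  symm : ∀ x y, R x y = R y x
  nonpos : ∀ (F : Finset X) (f : X → ℝ), ∑ x ∈ F, f x = 0 →
    ∑ x ∈ F, ∑ y ∈ F, f x * R x y * f y ≤ 0

namespace IsNegativeSemidefinite

variable {X : Type*} {R : X → X → ℝ} (hR : IsNegativeSemidefinite R)

/-- The finitely supported functions on `X` with sum zero. -/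
def sumZero (X : Type*) : Submodule ℝ (X →₀ ℝ) :=
  LinearMap.ker (Finsupp.linearCombination ℝ (fun _ : X => (1 : ℝ)))

/-- The space of finitely supported functions on `X` with sum zero, endowed with the
semi-inner product `Q(f, g) = - ∑ f x * R x y * g y`. -/
@[nolint unusedArguments]
def PreSpace (_ : IsNegativeSemidefinite R) : Type _ := sumZero X

instance : AddCommGroup hR.PreSpace := inferInstanceAs (AddCommGroup (sumZero X))
instance : Module ℝ hR.PreSpace := inferInstanceAs (Module ℝ (sumZero X))

/-- The function underlying an element of `PreSpace`. -/
def toFinsupp : hR.PreSpace →ₗ[ℝ] X →₀ ℝ := (sumZero X).subtype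

/-- The semi-inner product `Q(f, g) = - ∑ f x * R x y * g y`. -/
@[reducible]
def preCore : PreInnerProductSpace.Core ℝ hR.PreSpace where
  inner f g := -(hR.toFinsupp f).sum fun x a => (hR.toFinsupp g).sum fun y b => a * R x y * b
  conj_inner_symm f g := by
    rw [conj_trivial, Finsupp.sum_comm]
    refine congrArg Neg.neg (Finsupp.sum_congr fun x _ => Finsupp.sum_congr fun y _ => ?_)
    rw [hR.symm y x]
    ring
  re_inner_nonneg f := by
    have h0 : ∑ x ∈ (hR.toFinsupp f).support, hR.toFinsupp f x = 0 := by
      have h := (LinearMap.mem_ker.1 (Subtype.property (p := (· ∈ sumZero X)) f))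
      rw [Finsupp.linearCombination_apply] at h
      simp only [Finsupp.sum, smul_eq_mul, mul_one] at h
      exact h
    have := hR.nonpos _ _ h0
    simp only [Finsupp.sum, RCLike.re_to_real]
    linarith
  add_left f g h := by
    rw [map_add, Finsupp.sum_add_index']
    · ring
    · simp
    · intro x a b
      rw [← Finsupp.sum_add]
      exact Finsupp.sum_congr fun y _ => by ring
  smul_left f g r := by
    rw [map_smul, Finsupp.sum_smul_index (by simp), conj_trivial, mul_neg, Finsupp.mul_sum]
    refine congrArg Neg.neg (Finsupp.sum_congr fun x _ => ?_)
    rw [Finsupp.mul_sum]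
    exact Finsupp.sum_congr fun y _ => by ring

instance : SeminormedAddCommGroup hR.PreSpace :=
  InnerProductSpace.Core.toSeminormedAddCommGroup (c := hR.preCore)

instance : InnerProductSpace ℝ hR.PreSpace := InnerProductSpace.ofCore hR.preCore

/-- The von Neumann space of `(X, d)`, `R = d ^ 2`: the quotient of `PreSpace` by the kernel of
`Q`, completed. -/
abbrev VonNeumannSpace : Type _ := UniformSpace.Completion (SeparationQuotient hR.PreSpace)

/-- The element `(δ_x - δ_o) / √2` of `PreSpace`; the factor makes the embedding isometric, as
`Q(δ_x - δ_y, δ_x - δ_y) = 2 R x y` for `R` vanishing on the diagonal. -/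
def preEmbedding (o x : X) : hR.PreSpace :=
  (⟨(√2)⁻¹ • (Finsupp.single x 1 - Finsupp.single o 1), by
    simp [sumZero]⟩ : sumZero X)

/-- The von Neumann embedding of `(X, d)`, `R = d ^ 2`, with origin `o`. -/
def vonNeumannEmbedding (o x : X) : hR.VonNeumannSpace :=
  (SeparationQuotient.mk (hR.preEmbedding o x) : SeparationQuotient hR.PreSpace)

end IsNegativeSemidefinite

end

/-! Polarization (`inner_sub_sub`) expresses every inner product of differences `w x - w o` through
`R`. Hence two embeddings of the same `(X, R)` give each finite linear combination the same norm,
and density extends the correspondence to a unique unitary. The Hilbert space claims therefore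
reduce to identifying the two resistances as squared distances between kernels.

Put `w = v_x - v_y`, the Riesz representer of `u ↦ u x - u y`. Wired case: a function vanishing off
`H` is a function on the wired network grounded at `∞`, and its wired Laplacian at `z` is its inner
product with `δ_z`. So the wired voltage is the projection of `w` to the span of the `δ_z`, `z ∈ H`
(`wiredResistanceOn_eq`). These spans increase to a dense subspace of `Fin`, and the projections
converge strongly (`isWiredLimit`).

Free case: the voltage of `G k` represents the same functional for the energy restricted to `G k`.
Comparison with `w` gives `‖w‖² ≤ R_k`. Conversely, the voltages are pointwise bounded; a limit `l`
has energy at most `lim R_k` by a Fatou argument, and comparing it with `w` gives `lim R_k ≤ ‖w‖²`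
(`isFreeLimit`). -/

namespace IsVonNeumannEmbedding

/-! ### Von Neumann embeddings and their uniqueness -/

variable {X E : Type*} [NormedAddCommGroup E] [InnerProductSpace ℝ E] {R : X → X → ℝ} {w : X → E}

lemma self_eq_zero (hw : IsVonNeumannEmbedding R w) (x : X) : R x x = 0 := by
  rw [← hw.isometric]
  simp

lemma symm (hw : IsVonNeumannEmbedding R w) (x y : X) : R x y = R y x := by
  rw [← hw.isometric, ← hw.isometric, norm_sub_rev]

lemma inner_sub_sub (hw : IsVonNeumannEmbedding R w) (o x y : X) :
    inner ℝ (w x - w o) (w y - w o) = (R x o + R y o - R x y) / 2 := by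
  have h := norm_sub_sq_real (w x - w o) (w y - w o)
  rw [sub_sub_sub_cancel_right, hw.isometric, hw.isometric, hw.isometric] at h
  linarith

/-- When `∑ f = 0`, polarization turns `‖∑ f x • (w x - w o)‖²` into `-½ ∑ f x * R x y * f y`. -/
lemma isNegativeSemidefinite (hw : IsVonNeumannEmbedding R w) : IsNegativeSemidefinite R := by
  refine ⟨hw.symm, fun F f hf => ?_⟩
  rcases F.eq_empty_or_nonempty with rfl | ⟨o, -⟩
  · simp
  have h : 0 ≤ inner ℝ (∑ x ∈ F, f x • (w x - w o)) (∑ x ∈ F, f x • (w x - w o)) :=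
    real_inner_self_nonneg
  simp only [sum_inner, inner_sum, inner_smul_left, inner_smul_right, hw.inner_sub_sub,
    conj_trivial] at h
  -- The terms `R x o` and `R y o` each separate off a factor `∑ f`, which vanishes.
  have e : ∑ x ∈ F, ∑ y ∈ F, f x * (f y * ((R x o + R y o - R x y) / 2)) =
      (∑ x ∈ F, f x * R x o) * (∑ y ∈ F, f y) / 2 + (∑ x ∈ F, f x) * (∑ y ∈ F, f y * R y o) / 2 -
        (∑ x ∈ F, ∑ y ∈ F, f x * R x y * f y) / 2 := by
    simp only [Finset.sum_mul_sum, Finset.sum_div, ← Finset.sum_add_distrib,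
      ← Finset.sum_sub_distrib]
    exact Finset.sum_congr rfl fun x _ => Finset.sum_congr rfl fun y _ => by ring
  simp only [← Finset.mul_sum] at e
  have e' : ∀ x ∈ F, ∑ y ∈ F, f y * ((R y o + R x o - R y x) / 2) =
      ∑ y ∈ F, f y * ((R x o + R y o - R x y) / 2) := fun x _ =>
    Finset.sum_congr rfl fun y _ => by rw [hw.symm y x]; ring
  rw [Finset.sum_congr rfl fun x hx => congrArg (f x * ·) (e' x hx), e, hf] at h
  linarith

/-- The linear combinations of the differences `w x - w o` are dense. -/
lemma denseRange_linearCombination (hw : IsVonNeumannEmbedding R w) (o : X) :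
    DenseRange (Finsupp.linearCombination ℝ fun x => w x - w o) := by
  have h : Submodule.span ℝ (Set.range fun p : X × X => w p.1 - w p.2) ≤
      LinearMap.range (Finsupp.linearCombination ℝ fun x => w x - w o) := by
    rw [Submodule.span_le]
    rintro _ ⟨⟨x, y⟩, rfl⟩
    exact ⟨Finsupp.single x 1 - Finsupp.single y 1, by simp⟩
  have h' := Submodule.topologicalClosure_mono h
  rw [hw.dense, top_le_iff] at h'
  rw [DenseRange, ← LinearMap.coe_range]
  exact Submodule.dense_iff_topologicalClosure_eq_top.2 h'

/-- Both squared norms expand to the same expression in `R`, by polarization. This also makes the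
correspondence of the two families well defined. -/
lemma norm_linearCombination {E' : Type*} [NormedAddCommGroup E'] [InnerProductSpace ℝ E']
    {w' : X → E'} (hw : IsVonNeumannEmbedding R w) (hw' : IsVonNeumannEmbedding R w') (o : X)
    (f : X →₀ ℝ) : ‖Finsupp.linearCombination ℝ (fun x => w' x - w' o) f‖ =
      ‖Finsupp.linearCombination ℝ (fun x => w x - w o) f‖ := by
  rw [← sq_eq_sq₀ (norm_nonneg _) (norm_nonneg _), ← real_inner_self_eq_norm_sq,
    ← real_inner_self_eq_norm_sq]
  simp only [Finsupp.linearCombination_apply, Finsupp.sum, sum_inner, inner_sum, inner_smul_left,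
    inner_smul_right, hw.inner_sub_sub, hw'.inner_sub_sub]

/-- Two von Neumann embeddings of the same space are unitarily equivalent, uniquely. -/
theorem existsUnique_linearIsometryEquiv {E' : Type*} [NormedAddCommGroup E']
    [InnerProductSpace ℝ E'] [CompleteSpace E] [CompleteSpace E'] {w' : X → E'}
    (hw : IsVonNeumannEmbedding R w) (hw' : IsVonNeumannEmbedding R w') (o : X) :
    ∃! U : E ≃ₗᵢ[ℝ] E', ∀ x y, U (w x - w y) = w' x - w' y := by
  have hd := hw.denseRange_linearCombination o
  have hd' := hw'.denseRange_linearCombination o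
  obtain ⟨U, hU⟩ : ∃ U : E ≃ₗᵢ[ℝ] E', ∀ f,
      U (Finsupp.linearCombination ℝ (fun x => w x - w o) f) =
        Finsupp.linearCombination ℝ (fun x => w' x - w' o) f :=
    -- The identity on coefficients is isometric between two dense ranges, so it extends to the
    -- complete spaces.
    ⟨_, LinearEquiv.extendOfIsometry_eq (LinearEquiv.refl ℝ (X →₀ ℝ)) _ _ hd hd'
      (hw.norm_linearCombination hw' o)⟩
  refine ⟨U, fun x y => ?_, fun U' hU' => LinearIsometryEquiv.ext fun a => ?_⟩
  · have h := hU (Finsupp.single x (1 : ℝ) - Finsupp.single y (1 : ℝ))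
    rw [map_sub, map_sub] at h
    simpa using h
  · refine hd.induction_on (p := fun a => U' a = U a) a
      (isClosed_eq U'.continuous U.continuous) fun f => ?_
    rw [hU]
    simp only [Finsupp.linearCombination_apply, Finsupp.sum, map_sum, map_smul, hU']

end IsVonNeumannEmbedding

/-! ### Von Neumann's construction -/

namespace IsNegativeSemidefinite

variable {X : Type*} {R : X → X → ℝ} (hR : IsNegativeSemidefinite R)

lemma inner_preSpace (f g : hR.PreSpace) : inner ℝ f g =
    -(hR.toFinsupp f).sum fun x a => (hR.toFinsupp g).sum fun y b => a * R x y * b := rfl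

lemma toFinsupp_preEmbedding (o x : X) : hR.toFinsupp (hR.preEmbedding o x) =
    (√2)⁻¹ • (Finsupp.single x 1 - Finsupp.single o 1) := rfl

lemma toFinsupp_injective : Function.Injective hR.toFinsupp := Subtype.coe_injective

lemma sum_toFinsupp (f : hR.PreSpace) : (hR.toFinsupp f).sum (fun _ a => a) = 0 := by
  have h : Finsupp.linearCombination ℝ (fun _ : X => (1 : ℝ)) (hR.toFinsupp f) = 0 :=
    LinearMap.mem_ker.1 (Subtype.property (p := (· ∈ sumZero X)) f)
  simpa [Finsupp.linearCombination_apply] using h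

lemma preEmbedding_self (o : X) : hR.preEmbedding o o = 0 :=
  hR.toFinsupp_injective (by simp [toFinsupp_preEmbedding])

lemma vonNeumannEmbedding_self (o : X) : hR.vonNeumannEmbedding o o = 0 := by
  rw [vonNeumannEmbedding, preEmbedding_self]
  simp

lemma vonNeumannEmbedding_sub (o x y : X) :
    hR.vonNeumannEmbedding o x - hR.vonNeumannEmbedding o y =
      ((SeparationQuotient.mk (hR.preEmbedding o x - hR.preEmbedding o y) :
        SeparationQuotient hR.PreSpace) : hR.VonNeumannSpace) := by
  rw [SeparationQuotient.mk_sub, UniformSpace.Completion.coe_sub]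
  rfl

/-- The difference is `(δ_x - δ_y) / √2`; the diagonal terms of `Q` vanish and the two cross terms
contribute `½ R x y` each. -/
lemma norm_preEmbedding_sub_sq (h0 : ∀ x, R x x = 0) (o x y : X) :
    ‖hR.preEmbedding o x - hR.preEmbedding o y‖ ^ 2 = R x y := by
  have h : hR.toFinsupp (hR.preEmbedding o x - hR.preEmbedding o y) =
      Finsupp.single x (√2)⁻¹ + Finsupp.single y (-(√2)⁻¹) := by
    rw [map_sub, toFinsupp_preEmbedding, toFinsupp_preEmbedding, ← smul_sub,
      sub_sub_sub_cancel_right, smul_sub, sub_eq_add_neg]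
    simp
  have h2 : (√2)⁻¹ * (√2)⁻¹ = (1 / 2 : ℝ) := by
    rw [← mul_inv, Real.mul_self_sqrt (by norm_num)]
    norm_num
  have hs : ∀ (z : X) (a : ℝ),
      (Finsupp.single x (√2)⁻¹ + Finsupp.single y (-(√2)⁻¹)).sum (fun t b => a * R z t * b) =
        a * R z x * (√2)⁻¹ + a * R z y * (-(√2)⁻¹) := by
    intro z a
    rw [Finsupp.sum_add_index' (by simp) (by intros; ring), Finsupp.sum_single_index (by simp),
      Finsupp.sum_single_index (by simp)]
  rw [← real_inner_self_eq_norm_sq, inner_preSpace, h]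
  simp only [hs]
  rw [Finsupp.sum_add_index' (by simp) (by intros; ring), Finsupp.sum_single_index (by simp),
    Finsupp.sum_single_index (by simp), h0, h0, hR.symm y x]
  linear_combination 2 * R x y * h2

lemma span_preEmbedding_sub (o : X) : Submodule.span ℝ
    (Set.range fun p : X × X => hR.preEmbedding o p.1 - hR.preEmbedding o p.2) = ⊤ := by
  refine top_le_iff.1 fun f _ => ?_
  -- The factor `√2` undoes the normalization; the multiples of `δ_o` add up to `∑ f = 0`.
  have h : f = (hR.toFinsupp f).sum fun x a =>
      (a * √2) • (hR.preEmbedding o x - hR.preEmbedding o o) := by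
    apply hR.toFinsupp_injective
    have h2 : ∀ x a, hR.toFinsupp ((a * √2) • (hR.preEmbedding o x - hR.preEmbedding o o)) =
        Finsupp.single x a - Finsupp.single o a := by
      intro x a
      rw [preEmbedding_self, sub_zero, map_smul, toFinsupp_preEmbedding, smul_smul, mul_assoc,
        mul_inv_cancel₀ (by simp), mul_one, smul_sub]
      simp
    rw [Finsupp.sum, map_sum]
    simp only [h2]
    rw [Finset.sum_sub_distrib, ← Finsupp.single_finsetSum]
    have h3 := hR.sum_toFinsupp f
    have h4 := Finsupp.sum_single (hR.toFinsupp f)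
    rw [Finsupp.sum] at h3 h4
    rw [h3, h4]
    simp
  rw [h]
  exact Submodule.sum_mem _ fun x _ =>
    Submodule.smul_mem _ _ (Submodule.subset_span ⟨(x, o), rfl⟩)

/-- Von Neumann's construction is a von Neumann embedding. -/
lemma isVonNeumannEmbedding (h0 : ∀ x, R x x = 0) (o : X) :
    IsVonNeumannEmbedding R (hR.vonNeumannEmbedding o) := by
  refine ⟨fun x y => ?_, ?_⟩
  · rw [vonNeumannEmbedding_sub, UniformSpace.Completion.norm_coe, SeparationQuotient.norm_mk,
      norm_preEmbedding_sub_sq hR h0]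
  · rw [← Submodule.dense_iff_topologicalClosure_eq_top]
    let T : hR.PreSpace →ₗ[ℝ] hR.VonNeumannSpace :=
      (UniformSpace.Completion.toComplL (𝕜 := ℝ)
        (E := SeparationQuotient hR.PreSpace)).toLinearMap ∘ₗ
        (SeparationQuotient.mkCLM ℝ hR.PreSpace).toLinearMap
    have hT : DenseRange T :=
      (UniformSpace.Completion.denseRange_coe (α := SeparationQuotient hR.PreSpace)).comp
        SeparationQuotient.surjective_mk.denseRange
        (UniformSpace.Completion.continuous_coe _)
    -- The differences already span `PreSpace` algebraically, so the span of their images contains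
    -- the dense range of `T`.
    refine hT.mono ?_
    rintro _ ⟨f, rfl⟩
    have hf : f ∈ (⊤ : Submodule ℝ hR.PreSpace) := trivial
    rw [← hR.span_preEmbedding_sub o] at hf
    have h2 := Submodule.mem_map_of_mem (f := T) hf
    rw [Submodule.map_span, ← Set.range_comp] at h2
    refine Submodule.span_mono ?_ h2
    rintro _ ⟨p, rfl⟩
    exact ⟨p, hR.vonNeumannEmbedding_sub o p.1 p.2⟩

/-- Von Neumann's construction is the only von Neumann embedding, up to a unique unitary
isomorphism. -/
theorem existsUnique_linearIsometryEquiv {E : Type*} [NormedAddCommGroup E]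
    [InnerProductSpace ℝ E] [CompleteSpace E] {w : X → E} (hw : IsVonNeumannEmbedding R w) (o : X)
    (ho : w o = 0) :
    ∃! U : hR.VonNeumannSpace ≃ₗᵢ[ℝ] E, ∀ x, U (hR.vonNeumannEmbedding o x) = w x := by
  obtain ⟨U, hU, huniq⟩ := (hR.isVonNeumannEmbedding hw.self_eq_zero
    o).existsUnique_linearIsometryEquiv hw o
  refine ⟨U, fun x => ?_, fun U' hU' => huniq U' fun x y => by rw [map_sub, hU', hU']⟩
  simpa [vonNeumannEmbedding_self, ho] using hU x o

end IsNegativeSemidefinite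

/-! ### Voltages on finite networks -/

section FiniteNetwork

variable {W : Type*} [Fintype W] {c : W → W → ℝ}

/-- The Laplacian of a finite network is symmetric. -/
lemma sum_mul_finiteLaplacian_comm (hc : ∀ x y, c x y = c y x) (u v : W → ℝ) :
    ∑ z, u z * finiteLaplacian c v z = ∑ z, v z * finiteLaplacian c u z := by
  simp only [finiteLaplacian, mul_sub, Finset.sum_sub_distrib, Finset.mul_sum]
  congr 1
  · exact Finset.sum_congr rfl fun x _ => Finset.sum_congr rfl fun y _ => by ring
  · rw [Finset.sum_comm]
    exact Finset.sum_congr rfl fun x _ => Finset.sum_congr rfl fun y _ => by rw [hc]; ring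

lemma IsUnitVoltage.sum_mul {x y : W} {v : W → ℝ} (hv : IsUnitVoltage c x y v) (u : W → ℝ) :
    ∑ z, u z * finiteLaplacian c v z = u x - u y := by
  classical
  simp only [hv _, mul_sub, mul_ite, mul_one, mul_zero, Finset.sum_sub_distrib]
  simp

/-- The effective resistance may be computed from any voltage function. -/
lemma IsUnitVoltage.effectiveResistance_eq (hc : ∀ x y, c x y = c y x) {x y : W} {v : W → ℝ}
    (hv : IsUnitVoltage c x y v) : effectiveResistance c x y = v x - v y := by
  have h : IsUnitVoltage c x y (Classical.epsilon (IsUnitVoltage c x y)) :=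
    Classical.epsilon_spec ⟨v, hv⟩
  -- Pairing each voltage with the Laplacian of the other, symmetry equates the two drops;
  -- uniqueness of voltages up to constants is not needed.
  rw [effectiveResistance, ← hv.sum_mul, ← h.sum_mul, sum_mul_finiteLaplacian_comm hc]

lemma sum_finiteLaplacian (hc : ∀ x y, c x y = c y x) (v : W → ℝ) :
    ∑ z, finiteLaplacian c v z = 0 := by
  have h := sum_mul_finiteLaplacian_comm hc (fun _ => 1) v
  simpa [finiteLaplacian] using h

end FiniteNetwork

namespace ResistanceNetwork

variable {V : Type*} (N : ResistanceNetwork V)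

/-! ### Green's formula and the kernels -/

-- Green's formula for a Dirac mass. Only pairs with exactly one entry `z` contribute; the two
-- orientations give equal sums, which cancels the factor `1/2`.
open Classical in
lemma energy_dirac (z : V) (u : N.dom) :
    Summable (fun y => N.c z y * (u.1 z - u.1 y)) ∧
      inner ℝ (N.dirac z) (N.toEnergySpace u) = ∑' y, N.c z y * (u.1 z - u.1 y) := by
  set d : N.dom := ⟨fun y => if y = z then 1 else 0, N.dirac_mem_dom z⟩ with hd
  have hs := N.summable_energy d u
  set f : V × V → ℝ := fun p => N.c p.1 p.2 * (d.1 p.1 - d.1 p.2) * (u.1 p.1 - u.1 p.2) with hf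
  have hl : Function.Injective (fun y : V => (z, y)) := fun a b h => (Prod.mk.inj h).2
  have hr : Function.Injective (fun y : V => (y, z)) := fun a b h => (Prod.mk.inj h).1
  have fl : ∀ y, f (z, y) = N.c z y * (u.1 z - u.1 y) := by
    intro y
    by_cases h : y = z
    · simp [hf, h]
    · simp [hf, hd, h]
  have fr : ∀ y, f (y, z) = N.c z y * (u.1 z - u.1 y) := by
    intro y
    by_cases h : y = z
    · simp [hf, h]
    · simp only [hf, hd, h, if_true, if_false, N.c_symm y z]
      ring
  refine ⟨(hs.comp_injective hl).congr fun y => fl y, ?_⟩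
  have e1 : ∑' p : V × V, (Set.range (fun y : V => (z, y))).indicator f p =
      ∑' y, N.c z y * (u.1 z - u.1 y) := by
    rw [← tsum_subtype, tsum_range f hl]
    exact tsum_congr fl
  have e2 : ∑' p : V × V, (Set.range (fun y : V => (y, z))).indicator f p =
      ∑' y, N.c z y * (u.1 z - u.1 y) := by
    rw [← tsum_subtype, tsum_range f hr]
    exact tsum_congr fr
  -- The two ranges overlap only at `(z, z)`, where `f` vanishes.
  have e : ∀ p, f p = (Set.range (fun y : V => (z, y))).indicator f p +
      (Set.range (fun y : V => (y, z))).indicator f p := by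
    rintro ⟨a, b⟩
    by_cases ha : a = z <;> by_cases hb : b = z
    · subst ha hb
      simp [hf, N.c_self]
    · subst ha
      simp [Set.indicator, Ne.symm hb]
    · subst hb
      simp [Set.indicator, Ne.symm ha]
    · simp [Set.indicator, Ne.symm ha, Ne.symm hb, hf, hd, ha, hb]
  have h : inner ℝ (N.dirac z) (N.toEnergySpace u) = 1 / 2 * ∑' p, f p := rfl
  rw [h, tsum_congr e, (hs.indicator _).tsum_add (hs.indicator _), e1, e2]
  ring

lemma inner_energyKernel_sub (o x y : V) (u : N.dom) :
    inner ℝ (N.energyKernel o x - N.energyKernel o y) (N.toEnergySpace u) = u.1 x - u.1 y := by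
  rw [inner_sub_left, inner_energyKernel, inner_energyKernel]
  ring

lemma energyKernel_self (o : V) : N.energyKernel o o = 0 := by
  refine ext_inner_right ℝ fun a => ?_
  obtain ⟨u, rfl⟩ := N.toEnergySpace_surjective a
  rw [inner_energyKernel]
  simp

lemma finKernel_self (o : V) : N.finKernel o o = 0 := by
  rw [finKernel, energyKernel_self, map_zero]

lemma dirac_mem_finSpace (x : V) : N.dirac x ∈ N.FinSpace :=
  Submodule.le_topologicalClosure _ (Submodule.subset_span ⟨x, rfl⟩)

lemma inner_finKernel (o x : V) (a : N.FinSpace) :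
    inner ℝ (N.finKernel o x) a = inner ℝ (N.energyKernel o x) (a : N.EnergySpace) := by
  rw [finKernel, Submodule.inner_orthogonalProjectionOnto_eq_of_mem_right]

open Classical in
lemma inner_energyKernel_dirac (o x y : V) : inner ℝ (N.energyKernel o x) (N.dirac y) =
    (if x = y then 1 else 0) - (if o = y then 1 else 0) := by
  rw [dirac, inner_energyKernel]

/-- For `x ≠ y` the element `δ_x` of `Fin` separates `f_x` from `f_y`: the two inner products differ
by 1, even if `x` or `y` is `o`. -/
lemma finKernel_injective (o : V) : Function.Injective (N.finKernel o) := by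
  classical
  intro x y hxy
  by_contra hne
  have h := N.inner_finKernel o x ⟨_, N.dirac_mem_finSpace x⟩
  rw [hxy, inner_finKernel] at h
  simp only [inner_energyKernel_dirac, if_true, Ne.symm hne, if_false] at h
  linarith

lemma energyKernel_injective (o : V) : Function.Injective (N.energyKernel o) := fun _ _ h =>
  N.finKernel_injective o (congrArg N.FinSpace.orthogonalProjectionOnto h)

/-- Totality: a class orthogonal to all `v_x - v_o` has a constant representative. -/
lemma isVonNeumannEmbedding_energyKernel (o : V) {R : V → V → ℝ}
    (hR : ∀ x y, R x y = ‖N.energyKernel o x - N.energyKernel o y‖ ^ 2) :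
    IsVonNeumannEmbedding R (N.energyKernel o) := by
  refine ⟨fun _ _ => (hR _ _).symm, ?_⟩
  rw [Submodule.topologicalClosure_eq_top_iff, Submodule.eq_bot_iff]
  intro a ha
  obtain ⟨u, rfl⟩ := N.toEnergySpace_surjective a
  rw [← map_zero N.toEnergySpace, toEnergySpace_eq_iff]
  refine ⟨u.1 o, fun x => ?_⟩
  have h := (Submodule.mem_orthogonal _ _).1 ha _ (Submodule.subset_span ⟨(x, o), rfl⟩)
  rw [inner_energyKernel_sub] at h
  simp only [Submodule.coe_zero, Pi.zero_apply]
  linarith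

/-- Against elements of `Fin`, `f_x` acts as `v_x` does, so the same orthogonality argument applies
inside `Fin`. -/
lemma isVonNeumannEmbedding_finKernel (o : V) {R : V → V → ℝ}
    (hR : ∀ x y, R x y = ‖N.finKernel o x - N.finKernel o y‖ ^ 2) :
    IsVonNeumannEmbedding R (N.finKernel o) := by
  refine ⟨fun _ _ => (hR _ _).symm, ?_⟩
  rw [Submodule.topologicalClosure_eq_top_iff, Submodule.eq_bot_iff]
  rintro ⟨a, hmem⟩ ha
  refine Subtype.ext ?_
  obtain ⟨u, rfl⟩ := N.toEnergySpace_surjective a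
  change N.toEnergySpace u = 0
  rw [← map_zero N.toEnergySpace, toEnergySpace_eq_iff]
  refine ⟨u.1 o, fun x => ?_⟩
  have h := (Submodule.mem_orthogonal _ _).1 ha _ (Submodule.subset_span ⟨(x, o), rfl⟩)
  rw [inner_sub_left, inner_finKernel, inner_finKernel, ← inner_sub_left,
    inner_energyKernel_sub] at h
  simp only [Submodule.coe_zero, Pi.zero_apply]
  linarith

/-! ### Wired subnetworks -/

lemma wiredConductance_symm (H : Finset V) (a b : Option H) :
    N.wiredConductance H a b = N.wiredConductance H b a := by
  rcases a with _ | a <;> rcases b with _ | b <;> simp [wiredConductance, N.c_symm]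

/-- The span of the Dirac masses at the points of `H`. -/
def diracSpan (H : Finset V) : Submodule ℝ N.EnergySpace :=
  Submodule.span ℝ (N.dirac '' H)

instance (H : Finset V) : FiniteDimensional ℝ (N.diracSpan H) :=
  FiniteDimensional.span_of_finite ℝ (H.finite_toSet.image _)

lemma exists_of_mem_diracSpan {H : Finset V} {a : N.EnergySpace} (ha : a ∈ N.diracSpan H) :
    ∃ u : N.dom, N.toEnergySpace u = a ∧ ∀ z ∉ H, u.1 z = 0 := by
  classical
  induction ha using Submodule.span_induction with
  | mem a h =>
    obtain ⟨x, hx, rfl⟩ := h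
    exact ⟨_, rfl, fun z hz => if_neg fun (h : z = x) => hz (h ▸ hx)⟩
  | zero => exact ⟨0, map_zero _, fun z _ => rfl⟩
  | add a b _ _ iha ihb =>
    obtain ⟨u, rfl, hu⟩ := iha
    obtain ⟨v, rfl, hv⟩ := ihb
    exact ⟨u + v, map_add _ _ _, fun z hz => by simp [hu z hz, hv z hz]⟩
  | smul r a _ ih =>
    obtain ⟨u, rfl, hu⟩ := ih
    exact ⟨r • u, map_smul _ _ _, fun z hz => by simp [hu z hz]⟩

/-- The Laplacian of the wired subnetwork on `H` is the Laplacian of the whole network, for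
functions which are supported in `H`. -/
lemma finiteLaplacian_wiredConductance {H : Finset V} {u : N.dom} (hu : ∀ z ∉ H, u.1 z = 0)
    (z : H) : finiteLaplacian (N.wiredConductance H) (fun a => a.elim 0 fun b => u.1 b) (some z) =
      inner ℝ (N.dirac z) (N.toEnergySpace u) := by
  classical
  obtain ⟨hs, h⟩ := N.energy_dirac z u
  rw [h, ← hs.sum_add_tsum_compl (s := H), finiteLaplacian, Fintype.sum_option, add_comm]
  congr 1
  · exact Finset.sum_coe_sort H fun y => N.c z y * (u.1 z - u.1 y)
  -- Off `H` the function is 0, so the tail collapses to `u z` times the conductance to `∞`.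
  · simp only [wiredConductance, Option.elim, sub_zero]
    rw [tsum_subtype ((H : Set V)ᶜ) fun y => N.c z y * (u.1 z - u.1 y), ← tsum_mul_right]
    refine tsum_congr fun y => ?_
    by_cases hy : y ∈ H
    · simp [hy]
    · simp [hy, hu y hy]

/-- The wired resistance is computed by the projections to the spaces `diracSpan H`. -/
lemma wiredResistanceOn_eq {H : Finset V} {x y : V} (hx : x ∈ H) (hy : y ∈ H) (o : V) :
    N.wiredResistanceOn H x y = inner ℝ (N.energyKernel o x - N.energyKernel o y)
      ((N.diracSpan H).starProjection (N.energyKernel o x - N.energyKernel o y)) := by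
  classical
  set w := N.energyKernel o x - N.energyKernel o y with hw
  obtain ⟨u, hu, h0⟩ := N.exists_of_mem_diracSpan ((N.diracSpan H).starProjection_apply_mem w)
  have hd : ∀ z : H, finiteLaplacian (N.wiredConductance H)
      (fun a => a.elim 0 fun b => u.1 b) (some z) =
        (if (z : V) = x then 1 else 0) - (if (z : V) = y then 1 else 0) := by
    intro z
    have hz : N.dirac z ∈ N.diracSpan H := Submodule.subset_span ⟨z, z.2, rfl⟩
    -- The projection moves to `δ_z`, which it fixes.
    rw [N.finiteLaplacian_wiredConductance h0, hu, ← Submodule.inner_starProjection_left_eq_right,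
      Submodule.starProjection_eq_self_iff.2 hz, real_inner_comm, dirac, inner_energyKernel_sub]
    simp only [eq_comm]
  have hv : IsUnitVoltage (N.wiredConductance H) (some ⟨x, hx⟩) (some ⟨y, hy⟩)
      (fun a => a.elim 0 fun b => u.1 b) := by
    rintro (_ | z)
    -- The equation at `∞` follows from the others: both the Laplacian and the source sum to 0.
    · have h := sum_finiteLaplacian (N.wiredConductance_symm H) (fun a => a.elim 0 fun b => u.1 b)
      rw [Fintype.sum_option] at h
      simp only [hd, Finset.sum_sub_distrib] at h
      rw [Finset.sum_coe_sort H fun z => if z = x then (1 : ℝ) else 0,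
        Finset.sum_coe_sort H fun z => if z = y then (1 : ℝ) else 0] at h
      simpa [hx, hy] using h
    · rw [hd]
      simp [Subtype.ext_iff]
  rw [wiredResistanceOn, dif_pos ⟨hx, hy⟩, hv.effectiveResistance_eq (N.wiredConductance_symm H),
    ← hu, hw, inner_energyKernel_sub]
  rfl

lemma topologicalClosure_iSup_diracSpan {G : ℕ → Finset V} (hG : N.IsExhaustion G) :
    (⨆ k, N.diracSpan (G k)).topologicalClosure = N.FinSpace := by
  have h : ⋃ k, N.dirac '' (G k) = Set.range N.dirac := by
    rw [← Set.image_iUnion, ← Set.image_univ]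
    congr 1
    refine Set.eq_univ_of_forall fun x => Set.mem_iUnion.2 ?_
    simpa using hG.exhausts x
  simp only [diracSpan]
  rw [← Submodule.span_iUnion, h]
  rfl

lemma isWiredLimit (o x y : V) :
    N.IsWiredLimit x y (‖N.finKernel o x - N.finKernel o y‖ ^ 2) := by
  intro G hG
  set w := N.energyKernel o x - N.energyKernel o y with hw
  have hmono : Monotone fun k => N.diracSpan (G k) := fun i j hij =>
    Submodule.span_mono (Set.image_mono (hG.mono hij))
  have hcl := N.topologicalClosure_iSup_diracSpan hG
  have : (⨆ k, N.diracSpan (G k)).topologicalClosure.HasOrthogonalProjection := by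
    rw [hcl]; infer_instance
  have ht := Submodule.starProjection_tendsto_closure_iSup (𝕜 := ℝ) _ hmono w
  have h : (⨆ k, N.diracSpan (G k)).topologicalClosure.starProjection w =
      N.FinSpace.starProjection w := by
    congr
  rw [h] at ht
  have hn : ‖N.finKernel o x - N.finKernel o y‖ ^ 2 =
      inner ℝ w (N.FinSpace.starProjection w) := by
    rw [finKernel, finKernel, ← map_sub, ← hw, ← real_inner_self_eq_norm_sq,
      Submodule.inner_orthogonalProjectionOnto_eq_of_mem_right]
    rfl
  rw [hn]
  refine (tendsto_const_nhds.inner ht).congr' ?_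
  obtain ⟨i, hi⟩ := hG.exhausts x
  obtain ⟨j, hj⟩ := hG.exhausts y
  filter_upwards [eventually_ge_atTop i, eventually_ge_atTop j] with k hik hjk
  exact (N.wiredResistanceOn_eq (hG.mono hik hi) (hG.mono hjk hj) o).symm

end ResistanceNetwork

namespace ResistanceNetwork

variable {V : Type*} (N : ResistanceNetwork V)

/-! ### Free subnetworks -/

/-- The full subnetwork on a finite connected vertex set. -/
def subnetwork (H : Finset V) (hne : H.Nonempty)
    (hH : ∀ x ∈ H, ∀ y ∈ H, Relation.ReflTransGen (fun a b => a ∈ H ∧ b ∈ H ∧ 0 < N.c a b) x y) :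
    ResistanceNetwork H where
  c := N.freeConductance H
  c_nonneg _ _ := N.c_nonneg _ _
  c_symm _ _ := N.c_symm _ _
  c_self _ := N.c_self _
  summable_c _ := Summable.of_finite
  nonempty := hne.to_subtype
  connected := by
    rintro ⟨x, hx⟩ ⟨y, hy⟩
    induction hH x hx y hy with
    | refl => exact .refl
    | tail _ h ih => exact (ih h.1).tail h.2.2

/-- The part of (twice) the energy form which is carried by a finite set of edges. -/
noncomputable def edgeEnergy (s : Finset (V × V)) (u v : V → ℝ) : ℝ :=
  ∑ p ∈ s, N.c p.1 p.2 * (u p.1 - u p.2) * (v p.1 - v p.2)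

lemma edgeEnergy_mono {s t : Finset (V × V)} (hst : s ⊆ t) (u : V → ℝ) :
    N.edgeEnergy s u u ≤ N.edgeEnergy t u u :=
  Finset.sum_le_sum_of_subset_of_nonneg hst fun p _ _ => by
    rw [mul_assoc]
    exact mul_nonneg (N.c_nonneg _ _) (mul_self_nonneg _)

lemma edgeEnergy_sub_self (s : Finset (V × V)) (u v : V → ℝ) :
    N.edgeEnergy s u u - 2 * N.edgeEnergy s u v + N.edgeEnergy s v v =
      N.edgeEnergy s (u - v) (u - v) := by
  simp only [edgeEnergy, Finset.mul_sum, ← Finset.sum_sub_distrib, ← Finset.sum_add_distrib]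
  exact Finset.sum_congr rfl fun p _ => by simp only [Pi.sub_apply]; ring

lemma edgeEnergy_self_nonneg (s : Finset (V × V)) (u : V → ℝ) : 0 ≤ N.edgeEnergy s u u := by
  simpa [edgeEnergy] using N.edgeEnergy_mono s.empty_subset u

lemma edgeEnergy_le_energy (s : Finset (V × V)) (u : N.dom) :
    N.edgeEnergy s u.1 u.1 ≤ 2 * N.energy u u := by
  refine le_trans (le_of_eq (Finset.sum_congr rfl fun p _ => ?_)) (N.sum_le_energy u s)
  ring

/-- The Fatou step: a pointwise limit inherits bounds on finite edge sets, hence finite energy. The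
2 arises because `edgeEnergy` omits the factor `1/2`. -/
lemma dom_of_edgeEnergy_le {u : V → ℝ} {C : ℝ} (h : ∀ s, N.edgeEnergy s u u ≤ 2 * C) :
    ∃ hu : u ∈ N.dom, N.energy ⟨u, hu⟩ ⟨u, hu⟩ ≤ C := by
  have hs : ∀ s : Finset (V × V), ∑ p ∈ s, N.c p.1 p.2 * (u p.1 - u p.2) ^ 2 ≤ 2 * C :=
    fun s => le_trans (le_of_eq (Finset.sum_congr rfl fun p _ => by ring)) (h s)
  have hnn : ∀ p : V × V, 0 ≤ N.c p.1 p.2 * (u p.1 - u p.2) ^ 2 :=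
    fun p => mul_nonneg (N.c_nonneg _ _) (sq_nonneg _)
  refine ⟨summable_of_sum_le hnn hs, ?_⟩
  have h1 := Real.tsum_le_of_sum_le hnn hs
  unfold energy
  simp only [mul_assoc, ← sq]
  linarith

/-- Differences of values are controlled by the energy carried by finitely many edges. -/
lemma exists_edgeEnergy_bound (x y : V) : ∃ (C : ℝ) (s : Finset (V × V)),
    ∀ t, s ⊆ t → ∀ u, |u x - u y| ≤ C * √(N.edgeEnergy t u u) := by
  classical
  induction N.connected x y with
  | refl => exact ⟨0, ∅, fun t _ u => by simp⟩
  | @tail a b _ hab ih =>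
    obtain ⟨C, s, hC⟩ := ih
    -- Only the edges of one path matter, so the bound is uniform over all subnetworks containing
    -- that path.
    refine ⟨C + √(1 / N.c a b), insert (a, b) s, fun t ht u => ?_⟩
    have h1 : |u a - u b| ≤ √(1 / N.c a b) * √(N.edgeEnergy t u u) := by
      rw [← Real.sqrt_mul (by positivity)]
      apply Real.abs_le_sqrt
      rw [div_mul_eq_mul_div, le_div_iff₀ hab]
      have h := N.edgeEnergy_mono (Finset.singleton_subset_iff.2 (ht (Finset.mem_insert_self _ _))) u
      simp only [edgeEnergy, Finset.sum_singleton] at h ⊢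
      linarith
    calc |u x - u b| ≤ |u x - u a| + |u a - u b| := abs_sub_le _ _ _
      _ ≤ _ := by
        rw [add_mul]
        exact add_le_add (hC t ((Finset.subset_insert _ _).trans ht) u) h1

/-- The voltage function of the free subnetwork on `H`, extended to the whole vertex set. -/
lemma exists_free_voltage {H : Finset V} {x y : V} (hx : x ∈ H) (hy : y ∈ H)
    (hH : ∀ x ∈ H, ∀ y ∈ H, Relation.ReflTransGen (fun a b => a ∈ H ∧ b ∈ H ∧ 0 < N.c a b) x y) :
    ∃ v : V → ℝ, N.freeResistanceOn H x y = v x - v y ∧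
      ∀ u, N.edgeEnergy (H ×ˢ H) v u = 2 * (u x - u y) := by
  classical
  let M := N.subnetwork H ⟨x, hx⟩ hH
  -- Riesz representation in the finite network itself supplies the voltage.
  obtain ⟨v, hv⟩ := M.toEnergySpace_surjective
    (M.energyKernel ⟨x, hx⟩ ⟨x, hx⟩ - M.energyKernel ⟨x, hx⟩ ⟨y, hy⟩)
  have hvu : ∀ u, M.energy v u = u.1 ⟨x, hx⟩ - u.1 ⟨y, hy⟩ := fun u => by
    rw [← inner_toEnergySpace, hv, inner_energyKernel_sub]
  have hunit : IsUnitVoltage (N.freeConductance H) ⟨x, hx⟩ ⟨y, hy⟩ v.1 := by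
    intro z
    have h := (M.energy_dirac z v).2
    rw [real_inner_comm, dirac, inner_toEnergySpace, hvu, tsum_fintype] at h
    refine Eq.trans h.symm ?_
    congr 1 <;> simp only [eq_comm] <;> congr
  refine ⟨fun z => if h : z ∈ H then v.1 ⟨z, h⟩ else 0, ?_, fun u => ?_⟩
  · rw [freeResistanceOn, dif_pos ⟨hx, hy⟩,
      hunit.effectiveResistance_eq (c := N.freeConductance H) M.c_symm]
    simp only [hx, hy, dif_pos]
  · have h := hvu ⟨fun z => u z, Summable.of_finite⟩
    rw [energy, tsum_fintype, Fintype.sum_prod_type] at h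
    simp only at h
    rw [← h, edgeEnergy, Finset.sum_product, ← Finset.sum_coe_sort H]
    rw [← mul_assoc, mul_one_div_cancel two_ne_zero, one_mul]
    refine Finset.sum_congr rfl fun a _ => ?_
    rw [← Finset.sum_coe_sort H]
    refine Finset.sum_congr rfl fun b _ => ?_
    rw [dif_pos a.2, dif_pos b.2]
    rfl

lemma IsExhaustion.eventually_subset {G : ℕ → Finset V} (hG : N.IsExhaustion G)
    (s : Finset (V × V)) : ∀ᶠ k in atTop, s ⊆ G k ×ˢ G k := by
  have h : ∀ x, ∀ᶠ k in atTop, x ∈ G k := fun x => by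
    obtain ⟨i, hi⟩ := hG.exhausts x
    filter_upwards [eventually_ge_atTop i] with k hk using hG.mono hk hi
  have h2 : ∀ᶠ k in atTop, ∀ p ∈ s, p.1 ∈ G k ∧ p.2 ∈ G k :=
    (Filter.eventually_all_finset s).2 fun p _ => (h p.1).and (h p.2)
  filter_upwards [h2] with k hk p hp
  exact Finset.mem_product.2 (hk p hp)

lemma isFreeLimit (o x y : V) :
    N.IsFreeLimit x y (‖N.energyKernel o x - N.energyKernel o y‖ ^ 2) := by
  classical
  intro G hG
  set r := ‖N.energyKernel o x - N.energyKernel o y‖ ^ 2 with hr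
  obtain ⟨w, hw⟩ := N.toEnergySpace_surjective (N.energyKernel o x - N.energyKernel o y)
  have hwr : N.energy w w = r := by rw [energy_eq_norm_sq, hw]
  have hwu : ∀ u, N.energy w u = u.1 x - u.1 y := fun u => by
    rw [← inner_toEnergySpace, hw, inner_energyKernel_sub]
  set R := fun k => N.freeResistanceOn (G k) x y with hR
  have hxy : ∀ᶠ k in atTop, x ∈ G k ∧ y ∈ G k := by
    filter_upwards [hG.eventually_subset N {(x, y)}] with k hk
    exact Finset.mem_product.1 (hk (Finset.mem_singleton_self _))
  have hex : ∀ k, ∃ v : V → ℝ, (x ∈ G k ∧ y ∈ G k) → R k = v x - v y ∧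
      ∀ u, N.edgeEnergy (G k ×ˢ G k) v u = 2 * (u x - u y) := fun k => by
    by_cases h : x ∈ G k ∧ y ∈ G k
    · obtain ⟨v, hv⟩ := N.exists_free_voltage h.1 h.2 (hG.connected k)
      exact ⟨v, fun _ => hv⟩
    · exact ⟨0, fun h' => absurd h' h⟩
  choose v hv using hex
  have hlow : ∀ᶠ k in atTop, r ≤ R k := by
    filter_upwards [hxy] with k hk
    obtain ⟨h1, h2⟩ := hv k hk
    -- Expanding gives `0 ≤ 2 R_k - 4 r + E_k(w, w)`, and `E_k(w, w) ≤ 2 r`.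
    have h3 := N.edgeEnergy_self_nonneg (G k ×ˢ G k) (v k - w.1)
    rw [← edgeEnergy_sub_self, h2, h2, ← hwu, hwr, ← h1] at h3
    linarith [N.edgeEnergy_le_energy (G k ×ˢ G k) w]
  obtain ⟨C, hC⟩ : ∃ C, ∀ᶠ k in atTop, R k ≤ C := by
    obtain ⟨C, s, hC⟩ := N.exists_edgeEnergy_bound x y
    refine ⟨C ^ 2 * 2, ?_⟩
    filter_upwards [hxy, hG.eventually_subset N s, hlow] with k hk hs hl
    obtain ⟨h1, h2⟩ := hv k hk
    have h3 := hC _ hs (v k)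
    rw [h2, ← h1] at h3
    have hr0 : 0 ≤ r := sq_nonneg _
    have hRk : 0 ≤ R k := hr0.trans hl
    -- Squaring gives `R_k² ≤ 2 C² R_k`; then `R_k` is cancelled unless it is 0.
    have h4 := pow_le_pow_left₀ (abs_nonneg _) h3 2
    rw [sq_abs, mul_pow, Real.sq_sqrt (by linarith)] at h4
    rcases hRk.eq_or_lt with h0 | h0
    · rw [← h0]
      positivity
    · exact le_of_mul_le_mul_right (by linarith) h0
  -- Along an ultrafilter, bounded real sequences converge, so the voltages converge at all vertices
  -- at once without extracting a diagonal subsequence.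
  rw [tendsto_iff_ultrafilter]
  intro g hg
  have hlim : ∀ z, ∃ l, Tendsto (fun k => v k z - v k y) g (𝓝 l) := by
    intro z
    obtain ⟨D, s, hD⟩ := N.exists_edgeEnergy_bound z y
    have hb : ∀ᶠ k in g, v k z - v k y ∈ Metric.closedBall (0 : ℝ) (|D| * √(2 * C)) := by
      refine hg ?_
      filter_upwards [hxy, hG.eventually_subset N s, hC] with k hk hs hCk
      obtain ⟨h1, h2⟩ := hv k hk
      have h3 := hD _ hs (v k)
      rw [h2, ← h1] at h3
      rw [mem_closedBall_zero_iff, Real.norm_eq_abs]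
      refine h3.trans (mul_le_mul (le_abs_self D) (Real.sqrt_le_sqrt (by linarith))
        (Real.sqrt_nonneg _) (abs_nonneg _))
    obtain ⟨l, -, hl⟩ := (isCompact_closedBall (0 : ℝ) _).ultrafilter_le_nhds
      (g.map fun k => v k z - v k y) (le_principal_iff.2 hb)
    exact ⟨l, hl⟩
  choose l hl using hlim
  have hly : l y = 0 := tendsto_nhds_unique (hl y) (by simp)
  have hRl : Tendsto R g (𝓝 (l x)) := by
    refine (hl x).congr' (hg ?_)
    filter_upwards [hxy] with k hk using (hv k hk).1.symm
  have hle : ∀ s, N.edgeEnergy s l l ≤ 2 * l x := by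
    intro s
    have h1 : Tendsto (fun k => N.edgeEnergy s (v k) (v k)) g (𝓝 (N.edgeEnergy s l l)) := by
      have h2 : ∀ a b, Tendsto (fun k => v k a - v k b) g (𝓝 (l a - l b)) := fun a b =>
        ((hl a).sub (hl b)).congr fun k => by ring
      exact tendsto_finsetSum s fun p _ => ((h2 _ _).const_mul _).mul (h2 _ _)
    refine le_of_tendsto_of_tendsto h1 (hRl.const_mul 2) (hg ?_)
    filter_upwards [hxy, hG.eventually_subset N s] with k hk hs
    obtain ⟨h2, h3⟩ := hv k hk
    rw [h2, ← h3]
    exact N.edgeEnergy_mono hs _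
  obtain ⟨hdom, hen⟩ := N.dom_of_edgeEnergy_le hle
  have hup : l x ≤ r := by
    -- Since `E(l, l) ≤ l x` and `l y = 0`, this reads `0 ≤ r - 2 l x + E(l, l) ≤ r - l x`.
    have h1 := N.energy_self_nonneg (w - ⟨l, hdom⟩)
    rw [energy_eq_norm_sq, map_sub, norm_sub_sq_real, ← energy_eq_norm_sq, ← energy_eq_norm_sq,
      inner_toEnergySpace, hwr, hwu] at h1
    simp only [hly] at h1
    linarith
  have hlow' : r ≤ l x := ge_of_tendsto hRl (hg hlow)
  rwa [le_antisymm hlow' hup]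

/-! ### Exhaustions -/

/-- Summable conductances have countable support, so each set `S n` of endpoints of walks of length
`n` from `o` is countable. -/
lemma countable_vertices (N : ResistanceNetwork V) : Countable V := by
  obtain ⟨o⟩ := N.nonempty
  let S : ℕ → Set V := fun n => Nat.rec {o} (fun _ T => ⋃ x ∈ T, Function.support (N.c x)) n
  have hS : ∀ n, (S n).Countable := by
    intro n
    induction n with
    | zero => exact Set.countable_singleton o
    | succ n ih => exact ih.biUnion fun x _ => (N.summable_c x).countable_support
  have hall : ⋃ n, S n = Set.univ := by
    refine Set.eq_univ_of_forall fun x => ?_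
    induction N.connected o x with
    | refl => exact Set.mem_iUnion.2 ⟨0, rfl⟩
    | @tail a b _ hab ih =>
      obtain ⟨n, hn⟩ := Set.mem_iUnion.1 ih
      exact Set.mem_iUnion.2 ⟨n + 1, Set.mem_biUnion hn hab.ne'⟩
  rw [← Set.countable_univ_iff, ← hall]
  exact Set.countable_iUnion hS

/-- Every vertex lies in a finite vertex set, all of whose points can be reached from `o`
inside the set. -/
lemma exists_finset_reachable (o x : V) : ∃ H : Finset V, x ∈ H ∧ ∀ z ∈ H,
    Relation.ReflTransGen (fun a b => a ∈ H ∧ b ∈ H ∧ 0 < N.c a b) o z := by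
  classical
  induction N.connected o x with
  | refl =>
    refine ⟨{o}, Finset.mem_singleton_self o, fun z hz => ?_⟩
    rw [Finset.mem_singleton.1 hz]
  | @tail a b _ hab ih =>
    obtain ⟨H, ha, hH⟩ := ih
    have hmono : ∀ z ∈ H, Relation.ReflTransGen
        (fun a' b' => a' ∈ insert b H ∧ b' ∈ insert b H ∧ 0 < N.c a' b') o z := fun z hz =>
      Relation.ReflTransGen.mono (fun _ _ h =>
        ⟨Finset.mem_insert_of_mem h.1, Finset.mem_insert_of_mem h.2.1, h.2.2⟩) _ _ (hH z hz)
    refine ⟨insert b H, Finset.mem_insert_self b H, fun z hz => ?_⟩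
    rcases Finset.mem_insert.1 hz with rfl | hz
    · exact (hmono a ha).tail ⟨Finset.mem_insert_of_mem ha, Finset.mem_insert_self _ _, hab⟩
    · exact hmono z hz

lemma exists_isExhaustion : ∃ G : ℕ → Finset V, N.IsExhaustion G := by
  classical
  obtain ⟨o⟩ := N.nonempty
  have := N.countable_vertices
  have : Nonempty V := ⟨o⟩
  obtain ⟨e, he⟩ := exists_surjective_nat V
  choose H hmem hH using N.exists_finset_reachable o
  have hreach : ∀ k, ∀ z ∈ (Finset.range k).biUnion fun i => H (e i), Relation.ReflTransGen
      (fun a b => a ∈ ((Finset.range k).biUnion fun i => H (e i)) ∧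
        b ∈ ((Finset.range k).biUnion fun i => H (e i)) ∧ 0 < N.c a b) o z := by
    intro k z hz
    obtain ⟨i, hi, hz⟩ := Finset.mem_biUnion.1 hz
    exact Relation.ReflTransGen.mono (fun _ _ h => ⟨Finset.mem_biUnion.2 ⟨i, hi, h.1⟩,
      Finset.mem_biUnion.2 ⟨i, hi, h.2.1⟩, h.2.2⟩) _ _ (hH _ z hz)
  refine ⟨fun k => (Finset.range k).biUnion fun i => H (e i), ?_, fun x => ?_,
    fun k x hx y hy => ?_⟩
  · exact fun i j hij => Finset.biUnion_subset_biUnion_of_subset_left _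
      (Finset.range_subset_range.2 hij)
  · obtain ⟨i, rfl⟩ := he x
    exact ⟨i + 1, Finset.mem_biUnion.2 ⟨i, Finset.self_mem_range_succ i, hmem _⟩⟩
  -- Paths are joined through `o`, the first one reversed by symmetry of `c`.
  · refine Relation.ReflTransGen.trans ?_ (hreach k y hy)
    have : Std.Symm fun a b => a ∈ ((Finset.range k).biUnion fun i => H (e i)) ∧
        b ∈ ((Finset.range k).biUnion fun i => H (e i)) ∧ 0 < N.c a b :=
      ⟨fun a b h => ⟨h.2.1, h.1, N.c_symm a b ▸ h.2.2⟩⟩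
    exact symm_of _ (hreach k x hx)

/-! ### Resistances as squared distances -/

lemma isFreeLimit_freeResistance (x y : V) : N.IsFreeLimit x y (N.freeResistance x y) :=
  Classical.epsilon_spec ⟨_, N.isFreeLimit x x y⟩

lemma isWiredLimit_wiredResistance (x y : V) : N.IsWiredLimit x y (N.wiredResistance x y) :=
  Classical.epsilon_spec ⟨_, N.isWiredLimit x x y⟩

/-- An exhaustion must exist here: otherwise every real number would vacuously be a limit. -/
lemma freeResistance_eq (o x y : V) :
    N.freeResistance x y = ‖N.energyKernel o x - N.energyKernel o y‖ ^ 2 := by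
  obtain ⟨G, hG⟩ := N.exists_isExhaustion
  exact tendsto_nhds_unique (N.isFreeLimit_freeResistance x y G hG) (N.isFreeLimit o x y G hG)

lemma wiredResistance_eq (o x y : V) :
    N.wiredResistance x y = ‖N.finKernel o x - N.finKernel o y‖ ^ 2 := by
  obtain ⟨G, hG⟩ := N.exists_isExhaustion
  exact tendsto_nhds_unique (N.isWiredLimit_wiredResistance x y G hG) (N.isWiredLimit o x y G hG)

end ResistanceNetwork

theorem mainTheorem11 {V : Type*} (N : ResistanceNetwork V) (o : V) :
    -- the free and the wired resistance are well defined
    (∃ G : ℕ → Finset V, N.IsExhaustion G) ∧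
    (∀ x y, N.IsFreeLimit x y (N.freeResistance x y)) ∧
    (∀ x y, N.IsWiredLimit x y (N.wiredResistance x y)) ∧
    -- `x ↦ v_x` is an isometric embedding of `(V, R^F)` into `H_E`, whose image is total
    Function.Injective (N.energyKernel o) ∧
    IsVonNeumannEmbedding N.freeResistance (N.energyKernel o) ∧
    -- it is unitarily equivalent to von Neumann's construction
    (∃ hR : IsNegativeSemidefinite N.freeResistance,
      ∃! U : hR.VonNeumannSpace ≃ₗᵢ[ℝ] N.EnergySpace,
        ∀ x, U (hR.vonNeumannEmbedding o x) = N.energyKernel o x) ∧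
    -- and to every other embedding of `(V, R^F)` into a Hilbert space, with total image
    (∀ (K : Type*) [NormedAddCommGroup K] [InnerProductSpace ℝ K] [CompleteSpace K] (k : V → K),
      IsVonNeumannEmbedding N.freeResistance k →
        ∃! U : N.EnergySpace ≃ₗᵢ[ℝ] K,
          ∀ x y, U (N.energyKernel o x - N.energyKernel o y) = k x - k y) ∧
    -- the same for `x ↦ f_x`, from `(V, R^W)` into `Fin`
    Function.Injective (N.finKernel o) ∧
    IsVonNeumannEmbedding N.wiredResistance (N.finKernel o) ∧
    (∃ hR : IsNegativeSemidefinite N.wiredResistance,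
      ∃! U : hR.VonNeumannSpace ≃ₗᵢ[ℝ] N.FinSpace,
        ∀ x, U (hR.vonNeumannEmbedding o x) = N.finKernel o x) ∧
    (∀ (K : Type*) [NormedAddCommGroup K] [InnerProductSpace ℝ K] [CompleteSpace K] (k : V → K),
      IsVonNeumannEmbedding N.wiredResistance k →
        ∃! U : N.FinSpace ≃ₗᵢ[ℝ] K,
          ∀ x y, U (N.finKernel o x - N.finKernel o y) = k x - k y) := by
  have hF := N.isVonNeumannEmbedding_energyKernel o (N.freeResistance_eq o)
  have hW := N.isVonNeumannEmbedding_finKernel o (N.wiredResistance_eq o)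
  exact ⟨N.exists_isExhaustion, N.isFreeLimit_freeResistance, N.isWiredLimit_wiredResistance,
    N.energyKernel_injective o, hF,
    ⟨hF.isNegativeSemidefinite,
      hF.isNegativeSemidefinite.existsUnique_linearIsometryEquiv hF o (N.energyKernel_self o)⟩,
    fun _ _ _ _ _ hk => hF.existsUnique_linearIsometryEquiv hk o,
    N.finKernel_injective o, hW,
    ⟨hW.isNegativeSemidefinite,
      hW.isNegativeSemidefinite.existsUnique_linearIsometryEquiv hW o (N.finKernel_self o)⟩,
    fun _ _ _ _ _ hk => hW.existsUnique_linearIsometryEquiv hk o⟩
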